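/- **Proposition (graphical characterization of possibly-optimal intervention sets).** *Setting.* Let $\mathcal G$ be a causal diagram over a finite vertex set $\mathbf V$, i.e. a directed acyclic graph together with bidirected edges between distinct vertices, and let $Y\in\mathbf V$ be the reward variable. Write $\mathrm{Pa},\mathrm{An},\mathrm{De}$ for parents, ancestors and descendants along directed edges ($\mathrm{An}(\mathbf S)$ and $\mathrm{De}(\mathbf S)$ contain $\mathbf S$), and $\mathsf{CC}(\mathbf S)$ for the union of the connected components of the bidirected part that meet $\mathbf S$. $\mathcal G[\mathbf S]$ is the induced subgraph, and $\mathcal G_{\overline{\mathbf X}}$ is $\mathcal G$ with all directed edges into $\mathbf X$ and all bidirected edges with an endpoint in $\mathbf X$ removed. A set $\mathbf T\subseteq \mathrm{An}(Y)_{\mathcal G}$ with $Y\in\mathbf T$ is a *UC-territory* if, in $\mathcal H=\mathcal G[\mathrm{An}(Y)_{\mathcal G}]$, $\mathrm{De}(\mathbf T)_{\mathcal H}=\mathbf T$ and $\mathsf{CC}(\mathbf T)_{\mathcal H}=\mathbf T$. $\mathsf{MUCT}(\mathcal G,Y)$ is the (unique) minimal UC-territory, and $\mathsf{IB}(\mathcal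 G,Y)=\mathrm{Pa}(\mathbf T)_{\mathcal G}\setminus\mathbf T$ for $\mathbf T=\mathsf{MUCT}(\mathcal G,Y)$. An *SCM conforming to $\mathcal G$* has endogenous variables $\mathbf V$ with finite nonempty domains $\Omega_V$ ($Y$ real-valued), finitely many mutually independent exogenous variables, and for each $V\in\mathbf V$ a measurable mechanism whose arguments are the parents of $V$ in $\mathcal G$ and a set $\mathbf U_V$ of exogenous variables, such that for distinct $V,W$ one has $V\leftrightarrow W$ in $\mathcal G$ iff $\mathbf U_V\cap\mathbf U_W\neq\emptyset$. For $\mathbf X\subseteq\mathbf V\setminus\{Y\}$ and $\mathbf x\in\Omega_{\mathbf X}$ let $\mathbb E_{P_{\mathbf x}}Y$ be the expected reward under $do(\mathbf X=\mathbf x)$, and let $\mu^*_{\mathbf X}=\max_{\mathbf x\in\Omega_{\mathbf X}}\mathbb E_{P_{\mathbf x}}Y$. Sets $\mathbf X,\mathbf X'\subseteq\mathbf V\setminus\{Y\}$ are *equivalent* if $\mathbb E_{P_{\mathbf v[\mathbf X]}}Y=\mathbb E_{P_{\mathbf v[\mathbf X']}}Y$ for every SCM conforming to $\mathcal G$ and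 every assignment $\mathbf v\in\Omega_{\mathbf V}$, where $\mathbf v[\mathbf S]$ is the restriction of $\mathbf v$ to $\mathbf S$. A set $\mathbf X\subseteq\mathbf V\setminus\{Y\}$ is - a *minimal intervention set* (MIS) if it is not equivalent to any proper subset of itself; - a *possibly-optimal minimal intervention set* (POMIS) if it is an MIS and there is an SCM conforming to $\mathcal G$ in which $\mu^*_{\mathbf W}<\mu^*_{\mathbf X}$ for every MIS $\mathbf W\neq\mathbf X$; - a *possibly-optimal intervention set* (POIS) if there is an SCM conforming to $\mathcal G$ in which $\mu^*_{\mathbf W}<\mu^*_{\mathbf X}$ for every $\mathbf W\subseteq\mathbf V\setminus\{Y\}$ that is not equivalent to $\mathbf X$. *Claim.* Let $\mathbf X\subseteq\mathbf V\setminus\{Y\}$ and $\mathbf T_{\mathbf X}=\mathsf{MUCT}(\mathcal G_{\overline{\mathbf X}},Y)$. 1. If $\mathbf X$ is a POIS, then $\mathsf{IB}(\mathcal G_{\overline{\mathbf X}},Y)\subseteq\mathbf X$. 2. $\mathbf X$ is a POIS consisting of ancestors of $Y$ in $\mathcal G$ (i.e. $\mathbf X\subseteq\mathrm{An}(Y)_{\mathcal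 G}$) if and only if $$\mathsf{IB}(\mathcal G_{\overline{\mathbf X}},Y)\subseteq\mathbf X\subseteq\mathrm{An}(\mathbf T_{\mathbf X})_{\mathcal G}\setminus\mathbf T_{\mathbf X}.$$ 3. If $\mathbf X=\mathsf{IB}(\mathcal G_{\overline{\mathbf X}},Y)$, then $\mathbf X$ is a POMIS. -/

import Mathlib

open MeasureTheory

/-- A causal diagram (acyclic directed mixed graph): a directed acyclic graph `dir`
(`dir v w` means `v → w`) together with bidirected edges `v ↔ w`, which stand for unobserved
confounding. -/
structure CausalDiagram (V : Type*) where
  dir : V → V → Prop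
  bidir : SimpleGraph V
  acyclic : ∀ v, ¬ Relation.TransGen dir v v

namespace CausalDiagram

variable {V : Type*}

/-- `An(S)_G`: the ancestors of members of `S`, including `S` itself. -/
def An (G : CausalDiagram V) (S : Set V) : Set V :=
  {v | ∃ s ∈ S, Relation.ReflTransGen G.dir v s}

/-- `De(S)_G`: the descendants of members of `S`, including `S` itself. -/
def De (G : CausalDiagram V) (S : Set V) : Set V :=
  {v | ∃ s ∈ S, Relation.ReflTransGen G.dir s v}

/-- `Pa(S)_G`: the parents of members of `S`. -/
def Pa (G : CausalDiagram V) (S : Set V) : Set V :=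
  {v | ∃ s ∈ S, G.dir v s}

/-- `CC(S)_G`: the union of the maximal c-components (connected components of the bidirected part)
that meet `S`. -/
def CC (G : CausalDiagram V) (S : Set V) : Set V :=
  {v | ∃ s ∈ S, G.bidir.Reachable s v}

/-- The induced subgraph `G[S]`.  The vertex type is kept, so that the vertices outside `S` are
isolated; the sets of vertices considered in `G[S]` are always subsets of `S`. -/
def induce (G : CausalDiagram V) (S : Set V) : CausalDiagram V where
  dir v w := v ∈ S ∧ w ∈ S ∧ G.dir v w
  bidir :=
    { Adj := fun v w => v ∈ S ∧ w ∈ S ∧ G.bidir.Adj v w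
      symm := ⟨fun _ _ h => ⟨h.2.1, h.1, h.2.2.symm⟩⟩
      loopless := ⟨fun v h => G.bidir.irrefl h.2.2⟩ }
  acyclic _ h := G.acyclic _ (Relation.TransGen.mono (fun _ _ h => h.2.2) _ _ h)

/-- `G_{\overline X}`: all edges with an arrowhead at a member of `X` are deleted, that is, the
directed edges into `X` and the bidirected edges with an endpoint in `X`. -/
def removeIncoming (G : CausalDiagram V) (X : Set V) : CausalDiagram V where
  dir v w := w ∉ X ∧ G.dir v w
  bidir :=
    { Adj := fun v w => v ∉ X ∧ w ∉ X ∧ G.bidir.Adj v w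
      symm := ⟨fun _ _ h => ⟨h.2.1, h.1, h.2.2.symm⟩⟩
      loopless := ⟨fun v h => G.bidir.irrefl h.2.2⟩ }
  acyclic _ h := G.acyclic _ (Relation.TransGen.mono (fun _ _ h => h.2) _ _ h)

/-- `T` is an unobserved-confounders' territory on `G` with respect to `Y`. -/
def IsUCTerritory (G : CausalDiagram V) (Y : V) (T : Set V) : Prop :=
  Y ∈ T ∧ T ⊆ G.An {Y} ∧
    (G.induce (G.An {Y})).De T = T ∧ (G.induce (G.An {Y})).CC T = T

/-- `MUCT(G, Y)`: the minimal UC-territory, as the intersection of all UC-territories;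
see `minimal_muct` and `eq_muct_of_minimal`. -/
def MUCT (G : CausalDiagram V) (Y : V) : Set V :=
  ⋂₀ {T | G.IsUCTerritory Y T}

/-- `IB(G, Y)`, the interventional border. -/
def IB (G : CausalDiagram V) (Y : V) : Set V :=
  G.Pa (G.MUCT Y) \ G.MUCT Y

theorem isUCTerritory_an (G : CausalDiagram V) (Y : V) : G.IsUCTerritory Y (G.An {Y}) := by
  refine ⟨⟨Y, rfl, .refl⟩, subset_rfl, ?_, ?_⟩
  · refine subset_antisymm ?_ fun v hv => ⟨v, hv, .refl⟩
    rintro v ⟨s, hs, h⟩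
    induction h with
    | refl => exact hs
    | tail _ h _ =>
      obtain ⟨_, h, _⟩ := h
      exact h
  · refine subset_antisymm ?_ fun v hv => ⟨v, hv, .refl v⟩
    rintro v ⟨s, hs, ⟨p⟩⟩
    induction p with
    | nil => exact hs
    | cons h _ ih =>
      obtain ⟨_, h, _⟩ := h
      exact ih h

theorem isUCTerritory_muct (G : CausalDiagram V) (Y : V) : G.IsUCTerritory Y (G.MUCT Y) := by
  refine ⟨fun T hT => hT.1, fun v hv => hv _ (G.isUCTerritory_an Y), ?_, ?_⟩
  · refine subset_antisymm ?_ fun v hv => ⟨v, hv, .refl⟩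
    rintro v ⟨s, hs, h⟩ T hT
    rw [← hT.2.2.1]
    exact ⟨s, hs T hT, h⟩
  · refine subset_antisymm ?_ fun v hv => ⟨v, hv, .refl v⟩
    rintro v ⟨s, hs, h⟩ T hT
    rw [← hT.2.2.2]
    exact ⟨s, hs T hT, h⟩

/-- `MUCT(G, Y)` is a UC-territory no proper subset of which is one. -/
theorem minimal_muct (G : CausalDiagram V) (Y : V) : Minimal (G.IsUCTerritory Y) (G.MUCT Y) :=
  ⟨G.isUCTerritory_muct Y, fun _ hT _ => Set.sInter_subset_of_mem hT⟩

theorem eq_muct_of_minimal (G : CausalDiagram V) (Y : V) (T : Set V)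
    (hT : Minimal (G.IsUCTerritory Y) T) : T = G.MUCT Y :=
  subset_antisymm (hT.2 (G.isUCTerritory_muct Y) (Set.sInter_subset_of_mem hT.1))
    (Set.sInter_subset_of_mem hT.1)

theorem wellFounded_dir [Finite V] (G : CausalDiagram V) : WellFounded G.dir := by
  have : Std.Irrefl (Relation.TransGen G.dir) := ⟨G.acyclic⟩
  exact Subrelation.wf (fun h => Relation.TransGen.single h)
    (Finite.wellFounded_of_trans_of_irrefl (Relation.TransGen G.dir))

end CausalDiagram

/-- A structural causal model conforming to the causal diagram `G`, with reward variable `Y`.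
* The endogenous variables are the vertices; they have finite nonempty domains `Ω v`, and the
  reward is real valued: its domain is identified with a finite set of reals by `val`.
* The exogenous variables `j : ι` take values in arbitrary probability spaces and are mutually
  independent.
* The mechanism `f v` of `v` is a measurable function of the parents of `v` in `G` and of the
  exogenous variables `exo v`.
* Two distinct variables are joined by a bidirected edge of `G` exactly if they share an exogenous
  variable. -/
structure SCM {V : Type*} (G : CausalDiagram V) (Y : V) where
  Ω : V → Type
  finite_Ω : ∀ v, Finite (Ω v)
  nonempty_Ω : ∀ v, Nonempty (Ω v)
  val : Ω Y → ℝ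
  val_injective : Function.Injective val
  ι : Type
  fintype_ι : Fintype ι
  D : ι → Type
  measurableSpace_D : ∀ j, MeasurableSpace (D j)
  law : ∀ j, Measure (D j)
  isProbabilityMeasure_law : ∀ j, IsProbabilityMeasure (law j)
  exo : V → Set ι
  f : ∀ v, (∀ w : {w // G.dir w v}, Ω w) → (∀ j : exo v, D j) → Ω v
  measurable_f : ∀ v pa a, MeasurableSet {e | f v pa e = a}
  share_iff : ∀ v w, v ≠ w → (G.bidir.Adj v w ↔ (exo v ∩ exo w).Nonempty)

namespace SCM

variable {V : Type*} {G : CausalDiagram V} {Y : V}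

attribute [instance] SCM.fintype_ι SCM.measurableSpace_D SCM.isProbabilityMeasure_law
  SCM.finite_Ω SCM.nonempty_Ω

open Classical in
/-- The solution of the submodel `M_x` for the unit `u`.  Of the assignment `x` only the
coordinates in `X` are used, so that `x` stands for the element `x[X]` of `Ω_X`. -/
noncomputable def response [Finite V] (M : SCM G Y) (X : Set V) (x : ∀ v, M.Ω v)
    (u : ∀ j, M.D j) : ∀ v, M.Ω v :=
  G.wellFounded_dir.fix fun v rec =>
    if v ∈ X then x v else M.f v (fun w => rec w.1 w.2) (fun j => u j.1)

open Classical in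
theorem response_eq [Finite V] (M : SCM G Y) (X : Set V) (x : ∀ v, M.Ω v)
    (u : ∀ j, M.D j) (v : V) :
    M.response X x u v =
      if v ∈ X then x v else M.f v (fun w => M.response X x u w.1) (fun j => u j.1) :=
  G.wellFounded_dir.fix_eq _ v

/-- The expected reward `E_{P_x} Y` under the intervention `do(X = x[X])`. -/
noncomputable def expReward [Finite V] (M : SCM G Y) (X : Set V) (x : ∀ v, M.Ω v) : ℝ :=
  ∫ u, M.val (M.response X x u Y) ∂(Measure.pi M.law)

/-- The reward `E_{P_{x*}} Y` of a best intervention on `X`: a maximum, since there are only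
finitely many assignments. -/
noncomputable def optReward [Finite V] (M : SCM G Y) (X : Set V) : ℝ :=
  ⨆ x : ∀ v, M.Ω v, M.expReward X x

end SCM

namespace CausalDiagram

variable {V : Type*} [Finite V]

/-- `X` and `X'` are equivalent intervention sets: in every SCM conforming to `G`, setting `X` and
setting `X'` according to one and the same assignment give the same expected reward.  For
`X' ⊆ X` this says that `E_{P_x} Y = E_{P_{x[X']}} Y` for all `x` in `Ω_X`. -/
def EquivIS (G : CausalDiagram V) (Y : V) (X X' : Set V) : Prop :=
  ∀ (M : SCM G Y) (x : ∀ v, M.Ω v), M.expReward X x = M.expReward X' x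

/-- Minimal intervention set. -/
def IsMIS (G : CausalDiagram V) (Y : V) (X : Set V) : Prop :=
  Y ∉ X ∧ ¬ ∃ X', X' ⊂ X ∧ G.EquivIS Y X X'

/-- Possibly-optimal minimal intervention set: an MIS that in some SCM conforming to `G` is
strictly better than all other MISs. -/
def IsPOMIS (G : CausalDiagram V) (Y : V) (X : Set V) : Prop :=
  G.IsMIS Y X ∧ ∃ M : SCM G Y, ∀ W, G.IsMIS Y W → W ≠ X → M.optReward W < M.optReward X

/-- Possibly-optimal intervention set: an intervention set that in some SCM conforming to `G` is
strictly better than all intervention sets that are not equivalent to it. -/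
def IsPOIS (G : CausalDiagram V) (Y : V) (X : Set V) : Prop :=
  Y ∉ X ∧ ∃ M : SCM G Y, ∀ W, Y ∉ W → ¬ G.EquivIS Y X W → M.optReward W < M.optReward X

end CausalDiagram

/-!
Write `T` for `MUCT(G_{\overline X}, Y)` and `B` for its border `Pa(T) \ T`, which is
`IB(G_{\overline X}, Y)`. Two facts about rewards carry the argument.

* Additionally intervening on `B` never hurts: under `do(X)`, the values on `B` are independent of
  the noise of `T`, so the expected reward is an average of expected rewards under `do(X ∪ B)`.
* Conversely, there is an SCM in which `do(B)` beats every intervention that meets `T` or misses a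
  vertex of `B`. Its noise consists of fair coins. Every vertex of `T` tells its children what it
  knows about the coins of its ancestors in `T`, after checking that its parents' reports and its
  own coins have a common explanation; the reward is high if no check fails. Without interference
  in `T` none fails. If all checks passed in spite of an intervention meeting `T`, then, as `T` is
  swept out from `Y` along edges, some vertex fixed by the intervention would have to report a coin
  that is also seen by an unblocked vertex, although a constant cannot follow a coin.

Interventions that avoid `T` and contain `B` are all equivalent to `B`, so these facts decide
which sets are possibly optimal.
-/

section Preliminaries

theorem measurePreserving_piecewise_pi {ι : Type*} [Fintype ι] {D : ι → Type*}
    [∀ j, MeasurableSpace (D j)] (μ : ∀ j, Measure (D j)) [∀ j, IsProbabilityMeasure (μ j)]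
    (S : Set ι) [DecidablePred (· ∈ S)] :
    MeasurePreserving (fun p : (∀ j, D j) × (∀ j, D j) => S.piecewise p.1 p.2)
      ((Measure.pi μ).prod (Measure.pi μ)) (Measure.pi μ) := by
  have hmeas : Measurable fun p : (∀ j, D j) × (∀ j, D j) => S.piecewise p.1 p.2 := by
    refine measurable_pi_lambda _ fun j => ?_
    by_cases hj : j ∈ S <;> simp only [Set.piecewise, hj, if_true, if_false] <;> fun_prop
  refine ⟨hmeas, (Measure.pi_eq fun s hs => ?_).symm⟩
  have hpre : (fun p : (∀ j, D j) × (∀ j, D j) => S.piecewise p.1 p.2) ⁻¹' Set.univ.pi s =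
      (Set.univ.pi fun j => if j ∈ S then s j else Set.univ) ×ˢ
        (Set.univ.pi fun j => if j ∈ S then Set.univ else s j) := by
    ext p
    simp only [Set.mem_preimage, Set.mem_pi, Set.mem_univ, true_implies, Set.mem_prod,
      ← forall_and]
    refine forall_congr' fun j => ?_
    by_cases hj : j ∈ S <;> simp [hj]
  rw [Measure.map_apply hmeas (.univ_pi hs), hpre, Measure.prod_prod, Measure.pi_pi,
    Measure.pi_pi, ← Finset.prod_mul_distrib]
  refine Finset.prod_congr rfl fun j _ => ?_
  by_cases hj : j ∈ S <;> simp [hj]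

theorem exists_integral_le_integral_piecewise {ι : Type*} [Fintype ι] {D : ι → Type*}
    [∀ j, MeasurableSpace (D j)] (μ : ∀ j, Measure (D j)) [∀ j, IsProbabilityMeasure (μ j)]
    (S : Set ι) [DecidablePred (· ∈ S)] {F : (∀ j, D j) → ℝ} (hF : Integrable F (Measure.pi μ)) :
    ∃ u', ∫ u, F u ∂(Measure.pi μ) ≤ ∫ u, F (S.piecewise u u') ∂(Measure.pi μ) := by
  have hS := measurePreserving_piecewise_pi μ S
  have hint := hS.integrable_comp_of_integrable hF
  have hmean : ∫ u, F u ∂(Measure.pi μ) =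
      ∫ u', ∫ u, F (S.piecewise u u') ∂(Measure.pi μ) ∂(Measure.pi μ) := by
    have hmap := integral_map hS.aemeasurable (hS.map_eq.symm ▸ hF.aestronglyMeasurable)
    rw [hS.map_eq] at hmap
    exact hmap.trans (integral_prod_symm _ hint)
  rw [hmean]
  exact exists_integral_le hint.integral_prod_right

theorem integral_lt_of_le_of_lt_at_atom {α : Type*} [MeasurableSpace α] {μ : Measure α}
    [IsProbabilityMeasure μ] {f : α → ℝ} {c : ℝ} (hf : Integrable f μ) (hle : ∀ a, f a ≤ c)
    {a : α} (ha : μ {a} ≠ 0) (hlt : f a < c) : ∫ x, f x ∂μ < c := by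
  have hc : ∫ _, c ∂μ = c := by simp
  refine lt_of_le_of_ne ((integral_mono hf (integrable_const c) hle).trans_eq hc) fun h => ?_
  have hae : f =ᵐ[μ] fun _ => c :=
    (integral_eq_iff_of_ae_le hf (integrable_const c) (.of_forall hle)).1 (h.trans hc.symm)
  exact ha (measure_mono_null (Set.singleton_subset_iff.2 hlt.ne) hae)

theorem exists_injective_strictMono (α β : Type*) [PartialOrder α] [Countable α] [LinearOrder β]
    [DenselyOrdered β] [Nontrivial β] : ∃ f : α → β, Function.Injective f ∧ StrictMono f := by
  have : Countable (LinearExtension α) := ‹Countable α›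
  obtain ⟨e⟩ := Order.embedding_from_countable_to_dense (LinearExtension α) β
  have hinj : Function.Injective (e ∘ toLinearExtension) :=
    e.injective.comp fun _ _ h => h
  exact ⟨_, hinj, (e.monotone.comp toLinearExtension.monotone).strictMono_of_injective hinj⟩

end Preliminaries

namespace CausalDiagram

section Territories

variable {V : Type*} {G : CausalDiagram V} {X S T W : Set V} {Y v w : V}

/-- An edge along which UC-territories are closed: `v → w` or `v ↔ w`. -/
def Edge (G : CausalDiagram V) (v w : V) : Prop :=
  G.dir v w ∨ G.bidir.Adj v w

theorem mem_an_singleton : v ∈ G.An {Y} ↔ Relation.ReflTransGen G.dir v Y :=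
  exists_eq_left

theorem reflTransGen_dir_of_induce (h : Relation.ReflTransGen (G.induce S).dir v w) :
    Relation.ReflTransGen G.dir v w :=
  Relation.ReflTransGen.mono (fun _ _ h => h.2.2) _ _ h

theorem isUCTerritory_iff :
    G.IsUCTerritory Y T ↔
      Y ∈ T ∧ T ⊆ G.An {Y} ∧ ∀ v ∈ T, ∀ w ∈ G.An {Y}, G.Edge v w → w ∈ T := by
  refine ⟨fun ⟨hY, hsub, hDe, hCC⟩ => ⟨hY, hsub, fun v hv w hw hvw => ?_⟩,
    fun ⟨hY, hsub, hclosed⟩ => ⟨hY, hsub, ?_, ?_⟩⟩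
  · rcases hvw with h | h
    · exact hDe.subset ⟨v, hv, .single ⟨hsub hv, hw, h⟩⟩
    · exact hCC.subset ⟨v, hv, SimpleGraph.Adj.reachable ⟨hsub hv, hw, h⟩⟩
  · refine subset_antisymm ?_ fun v hv => ⟨v, hv, .refl⟩
    rintro w ⟨v, hv, h⟩
    induction h with
    | refl => exact hv
    | tail _ h ih => exact hclosed _ ih _ h.2.1 (.inl h.2.2)
  · refine subset_antisymm ?_ fun v hv => ⟨v, hv, .refl v⟩
    rintro w ⟨v, hv, ⟨p⟩⟩
    induction p with
    | nil => exact hv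
    | cons h _ ih => exact ih (hclosed _ hv _ h.2.1 (.inr h.2.2))

theorem muct_subset_an : G.MUCT Y ⊆ G.An {Y} :=
  (G.isUCTerritory_muct Y).2.1

theorem mem_muct_of_edge (hv : v ∈ G.MUCT Y) (hw : w ∈ G.An {Y}) (h : G.Edge v w) :
    w ∈ G.MUCT Y :=
  (isUCTerritory_iff.1 (G.isUCTerritory_muct Y)).2.2 v hv w hw h

/-- `T` consists of ancestors of `Y` in `G[T]` and is swept out by the edges of `G[T]` starting
from `Y`, that is, `T = MUCT(G[T], Y)`. Unlike being
`MUCT(G_{\overline X}, Y)`, this does not refer to `X`. -/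
structure IsUCGenerated (G : CausalDiagram V) (Y : V) (T : Set V) : Prop where
  mem : Y ∈ T
  reaches : ∀ t ∈ T, Relation.ReflTransGen (G.induce T).dir t Y
  reached : ∀ t ∈ T, Relation.ReflTransGen (G.induce T).Edge Y t

theorem isUCGenerated_muct (G : CausalDiagram V) (Y : V) : G.IsUCGenerated Y (G.MUCT Y) := by
  have hY : Y ∈ G.MUCT Y := (G.isUCTerritory_muct Y).1
  refine ⟨hY, fun t ht => ?_, fun t ht => ?_⟩
  · have htY := mem_an_singleton.1 (muct_subset_an ht)
    induction htY using Relation.ReflTransGen.head_induction_on with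
    | refl => exact .refl
    | head htc hcY ih =>
      have hc := mem_muct_of_edge ht (mem_an_singleton.2 hcY) (.inl htc)
      exact .head ⟨ht, hc, htc⟩ (ih hc)
  · let R : Set V := {t | t ∈ G.MUCT Y ∧ Relation.ReflTransGen (G.induce (G.MUCT Y)).Edge Y t}
    have hR : G.IsUCTerritory Y R := by
      refine isUCTerritory_iff.2 ⟨⟨hY, .refl⟩, fun v hv => muct_subset_an hv.1, ?_⟩
      intro v ⟨hv, hYv⟩ w hwY hvw
      have hw := mem_muct_of_edge hv hwY hvw
      exact ⟨hw, hYv.tail (hvw.imp (⟨hv, hw, ·⟩) (⟨hv, hw, ·⟩))⟩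
    have hsub : G.MUCT Y ⊆ R := Set.sInter_subset_of_mem hR
    exact (hsub ht).2

theorem IsUCGenerated.of_removeIncoming (hT : (G.removeIncoming X).IsUCGenerated Y T) :
    G.IsUCGenerated Y T where
  mem := hT.mem
  reaches t ht := Relation.ReflTransGen.mono (fun _ _ h => ⟨h.1, h.2.1, h.2.2.2⟩) _ _
    (hT.reaches t ht)
  reached t ht := Relation.ReflTransGen.mono
    (fun _ _ h => h.imp (fun h => ⟨h.1, h.2.1, h.2.2.2⟩) fun h => ⟨h.1, h.2.1, h.2.2.2.2⟩) _ _
    (hT.reached t ht)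

theorem isUCGenerated_muct_removeIncoming (G : CausalDiagram V) (Y : V) (X : Set V) :
    G.IsUCGenerated Y ((G.removeIncoming X).MUCT Y) :=
  ((G.removeIncoming X).isUCGenerated_muct Y).of_removeIncoming

theorem IsUCGenerated.not_dir (hT : G.IsUCGenerated Y T) (ht : v ∈ T) : ¬ G.dir Y v :=
  fun h => G.acyclic Y (.head' h (reflTransGen_dir_of_induce (hT.reaches v ht)))

theorem IsUCGenerated.an_eq (hT : G.IsUCGenerated Y T) : G.An T = G.An {Y} := by
  refine subset_antisymm ?_ fun v hv => ⟨Y, hT.mem, mem_an_singleton.1 hv⟩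
  rintro v ⟨t, ht, hvt⟩
  exact mem_an_singleton.2 (hvt.trans (reflTransGen_dir_of_induce (hT.reaches t ht)))

theorem IsUCGenerated.exists_edge_of_not_subset (hT : G.IsUCGenerated Y T) (hY : Y ∈ S)
    (hS : ¬ T ⊆ S) : ∃ v ∈ S, ∃ w ∈ T \ S, v ∈ T ∧ G.Edge v w := by
  obtain ⟨t, ht, htS⟩ := Set.not_subset.1 hS
  by_contra! hno
  refine htS ?_
  induction hT.reached t ht with
  | refl => exact hY
  | @tail v w _ hvw ih =>
    obtain ⟨hv, hw, h⟩ : v ∈ T ∧ w ∈ T ∧ G.Edge v w :=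
      hvw.elim (fun h => ⟨h.1, h.2.1, .inl h.2.2⟩) fun h => ⟨h.1, h.2.1, .inr h.2.2⟩
    by_contra hwS
    have hvS : v ∈ S := by
      by_contra hvS
      exact hvS (ih hv hvS)
    exact hno v hvS w ⟨hw, hwS⟩ hv h

/-- The vertices of `T` whose reports still influence `Y` under an intervention on `W`. -/
def unblocked (G : CausalDiagram V) (Y : V) (T W : Set V) : Set V :=
  (G.induce (T \ W)).An {Y}

theorem self_mem_unblocked : Y ∈ G.unblocked Y T W :=
  mem_an_singleton.2 .refl

theorem unblocked_subset (hY : Y ∈ T \ W) : G.unblocked Y T W ⊆ T \ W := by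
  intro v hv
  rcases (mem_an_singleton.1 hv).cases_head with rfl | ⟨_, h, -⟩
  exacts [hY, h.1]

theorem mem_unblocked_of_dir (hY : Y ∈ T \ W) (hv : v ∈ T \ W) (hw : w ∈ G.unblocked Y T W)
    (h : G.dir v w) : v ∈ G.unblocked Y T W :=
  mem_an_singleton.2 (.head ⟨hv, unblocked_subset hY hw, h⟩ (mem_an_singleton.1 hw))

theorem disjoint_muct_removeIncoming (hX : Y ∉ X) : Disjoint X ((G.removeIncoming X).MUCT Y) := by
  refine Set.disjoint_right.2 fun t ht => ?_
  rcases ((G.removeIncoming X).isUCGenerated_muct Y).reached t ht |>.cases_tail with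
    rfl | ⟨_, -, h | h⟩
  exacts [hX, h.2.2.1, h.2.2.2.1]

theorem ib_removeIncoming (hX : Y ∉ X) :
    (G.removeIncoming X).IB Y =
      G.Pa ((G.removeIncoming X).MUCT Y) \ (G.removeIncoming X).MUCT Y := by
  have hdisj := Set.disjoint_right.1 (disjoint_muct_removeIncoming (G := G) hX)
  exact congrArg (· \ _) <| Set.ext fun v =>
    exists_congr fun t => and_congr_right fun ht => and_iff_right (hdisj ht)

/-- Intervening on `X` cuts `T` off from the rest of the diagram without interfering in `T`. -/
structure Isolates (G : CausalDiagram V) (X T : Set V) : Prop where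
  disjoint : Disjoint X T
  border_subset : G.Pa T \ T ⊆ X

theorem isolates_border (G : CausalDiagram V) (T : Set V) : G.Isolates (G.Pa T \ T) T :=
  ⟨Set.disjoint_sdiff_left, subset_rfl⟩

theorem isolates_union_ib (hX : Y ∉ X) :
    G.Isolates (X ∪ (G.removeIncoming X).IB Y) ((G.removeIncoming X).MUCT Y) :=
  ⟨Set.disjoint_union_left.2 ⟨disjoint_muct_removeIncoming hX, Set.disjoint_sdiff_left⟩,
    ib_removeIncoming (G := G) hX ▸ Set.subset_union_right⟩

end Territories

end CausalDiagram

namespace SCM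

open CausalDiagram

variable {V : Type*} [Finite V] {G : CausalDiagram V} {Y : V}

section Response

variable (M : SCM G Y) {X W T : Set V} {v : V}

theorem response_of_mem (hv : v ∈ X) (x : ∀ v, M.Ω v) (u : ∀ j, M.D j) :
    M.response X x u v = x v := by
  rw [response_eq, if_pos hv]

theorem response_of_notMem (hv : v ∉ X) (x : ∀ v, M.Ω v) (u : ∀ j, M.D j) :
    M.response X x u v = M.f v (fun w => M.response X x u w.1) (fun j => u j.1) := by
  rw [response_eq, if_neg hv]

theorem response_congr_of_border (hX : Disjoint X T) (hW : Disjoint W T) {x x' : ∀ v, M.Ω v}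
    {u u' : ∀ j, M.D j} (hu : ∀ t ∈ T, ∀ j ∈ M.exo t, u j = u' j)
    (hborder : ∀ b ∈ G.Pa T \ T, M.response X x u b = M.response W x' u' b) (hv : v ∈ T) :
    M.response X x u v = M.response W x' u' v := by
  induction v using G.wellFounded_dir.induction with
  | _ v ih =>
    rw [M.response_of_notMem (Set.disjoint_right.1 hX hv),
      M.response_of_notMem (Set.disjoint_right.1 hW hv)]
    congr 1
    · funext p
      by_cases hp : p.1 ∈ T
      · exact ih _ p.2 hp
      · exact hborder _ ⟨⟨v, hv, p.2⟩, hp⟩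
    · funext j
      exact hu v hv j j.2

theorem measurableSet_response_eq (X : Set V) (x : ∀ v, M.Ω v) (v : V) (a : M.Ω v) :
    MeasurableSet {u | M.response X x u v = a} := by
  induction v using G.wellFounded_dir.induction with
  | _ v ih =>
    by_cases hv : v ∈ X
    · simp only [M.response_of_mem hv, MeasurableSet.const]
    · have hsplit : {u | M.response X x u v = a} = ⋃ pa : ∀ w : {w // G.dir w v}, M.Ω w,
          (⋂ w, {u | M.response X x u w.1 = pa w}) ∩
            (fun (u : ∀ j, M.D j) (j : M.exo v) => u j.1) ⁻¹' {e | M.f v pa e = a} := by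
        ext u
        simp only [M.response_of_notMem hv, Set.mem_ofPred_eq, Set.mem_iUnion, Set.mem_inter_iff,
          Set.mem_iInter, Set.mem_preimage, ← funext_iff, exists_eq_left']
      rw [hsplit]
      refine .iUnion fun pa => .inter (.iInter fun w => ih _ w.2 _) ?_
      exact (measurable_pi_lambda _ fun j => measurable_pi_apply j.1) (M.measurable_f v pa a)

theorem integrable_reward (X : Set V) (x : ∀ v, M.Ω v) :
    Integrable (fun u => M.val (M.response X x u Y)) (Measure.pi M.law) := by
  let _ : MeasurableSpace (M.Ω Y) := ⊤
  have hmeas : Measurable fun u => M.val (M.response X x u Y) :=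
    (measurable_from_top (f := M.val)).comp
      (measurable_to_countable' fun a => M.measurableSet_response_eq X x Y a)
  obtain ⟨C, hC⟩ := (Set.finite_range fun a => ‖M.val a‖).bddAbove
  exact .of_bound hmeas.aestronglyMeasurable C (.of_forall fun _ => hC ⟨_, rfl⟩)

theorem expReward_le_optReward (X : Set V) (x : ∀ v, M.Ω v) :
    M.expReward X x ≤ M.optReward X :=
  le_ciSup (Set.finite_range fun x => M.expReward X x).bddAbove x

theorem exists_expReward_eq_optReward (X : Set V) : ∃ x, M.expReward X x = M.optReward X :=
  exists_eq_ciSup_of_finite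

end Response

section Border

variable (M : SCM G Y) {X T : Set V}

theorem expReward_eq_of_isolates (hY : Y ∈ T) (hX : G.Isolates X T) (x : ∀ v, M.Ω v) :
    M.expReward X x = M.expReward (G.Pa T \ T) x := by
  refine integral_congr_ae (.of_forall fun u => congrArg M.val ?_)
  refine M.response_congr_of_border hX.disjoint (G.isolates_border T).disjoint
    (fun _ _ _ _ => rfl) (fun b hb => ?_) hY
  rw [M.response_of_mem (hX.border_subset hb), M.response_of_mem hb]

theorem response_ib_congr (hX : Y ∉ X) (x : ∀ v, M.Ω v) {u u' : ∀ j, M.D j}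
    (hu : ∀ j, (∀ t ∈ (G.removeIncoming X).MUCT Y, j ∉ M.exo t) → u j = u' j) {b : V}
    (hb : b ∈ (G.removeIncoming X).IB Y) : M.response X x u b = M.response X x u' b := by
  set H := G.removeIncoming X
  have hTX := Set.disjoint_right.1 (disjoint_muct_removeIncoming (G := G) hX)
  have parent_mem_an {p v : V} (hv : v ∈ H.An {Y}) (hvX : v ∉ X) (hpv : G.dir p v) :
      p ∈ H.An {Y} :=
    mem_an_singleton.2 (.head ⟨hvX, hpv⟩ (mem_an_singleton.1 hv))
  obtain ⟨⟨t, ht, htb⟩, hbT⟩ := hb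
  have hbA : b ∈ H.An {Y} := parent_mem_an (muct_subset_an ht) (hTX ht) htb.2
  by_cases hbX : b ∈ X
  · rw [M.response_of_mem hbX, M.response_of_mem hbX]
  -- The part of `H[An(Y)]` outside the MUCT receives no edge from the MUCT.
  refine M.response_congr_of_border (T := (H.An {Y} \ H.MUCT Y) \ X) Set.disjoint_sdiff_right
    Set.disjoint_sdiff_right ?_ ?_ ⟨⟨hbA, hbT⟩, hbX⟩
  · rintro v ⟨⟨hvA, hvT⟩, hvX⟩ j hj
    refine hu j fun t ht htj => hvT (mem_muct_of_edge ht hvA (.inr ⟨hTX ht, hvX, ?_⟩))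
    exact (M.share_iff _ _ (ne_of_mem_of_not_mem ht hvT)).2 ⟨j, htj, hj⟩
  · rintro p ⟨⟨v, ⟨⟨hvA, hvT⟩, hvX⟩, hpv⟩, hp⟩
    have hpT : p ∉ H.MUCT Y := fun hpT => hvT (mem_muct_of_edge hpT hvA (.inl ⟨hvX, hpv⟩))
    have hpX : p ∈ X := by
      by_contra hpX
      exact hp ⟨⟨parent_mem_an hvA hvX hpv, hpT⟩, hpX⟩
    rw [M.response_of_mem hpX, M.response_of_mem hpX]

theorem optReward_le_optReward_union_ib (hX : Y ∉ X) :
    M.optReward X ≤ M.optReward (X ∪ (G.removeIncoming X).IB Y) := by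
  classical
  set T := (G.removeIncoming X).MUCT Y
  set W := X ∪ (G.removeIncoming X).IB Y
  have hW : G.Isolates W T := isolates_union_ib hX
  obtain ⟨x, hx⟩ := M.exists_expReward_eq_optReward X
  let S : Set M.ι := {j | ∃ t ∈ T, j ∈ M.exo t}
  have hresponse (u u' : ∀ j, M.D j) :
      M.response X x (S.piecewise u u') Y = M.response W (M.response X x u') u Y := by
    refine M.response_congr_of_border (disjoint_muct_removeIncoming hX) hW.disjoint
      (fun t ht j hj => Set.piecewise_eq_of_mem _ _ _ ⟨t, ht, hj⟩) (fun b hb => ?_)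
      (G.isUCGenerated_muct_removeIncoming Y X).mem
    rw [M.response_of_mem (hW.border_subset hb)]
    refine M.response_ib_congr hX x (fun j hj => ?_) (by rwa [ib_removeIncoming hX])
    exact Set.piecewise_eq_of_notMem _ _ _ fun ⟨t, ht, htj⟩ => hj t ht htj
  obtain ⟨u', hu'⟩ := exists_integral_le_integral_piecewise M.law S (M.integrable_reward X x)
  simp only [hresponse] at hu'
  calc M.optReward X = M.expReward X x := hx.symm
    _ ≤ M.expReward W (M.response X x u') := hu'
    _ ≤ M.optReward W := M.expReward_le_optReward W _

end Border

end SCM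

namespace CausalDiagram

variable {V : Type*} [Finite V]

section Reports

/-- A state of the noise of `reportSCM`: one bit for each unordered pair of vertices. `Shrink` moves
the index set to the universe that `SCM` asks for. -/
abbrev NoiseState (V : Type*) [Finite V] : Type :=
  Shrink.{0} (Sym2 V) → Bool

/-- The noise variables of `v`: a private one, and one for each bidirected edge at `v`. -/
def noise (G : CausalDiagram V) (v : V) : Set (Shrink.{0} (Sym2 V)) :=
  equivShrink.{0} (Sym2 V) '' insert s(v, v) (G.bidir.incidenceSet v)

/-- The noise variables about which `v` reports to its children: those of its ancestors in `G[T]`.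
Vertices outside `T` report on nothing, and neither does `Y`, whose value is to tell only whether
its own check has failed. -/
def reportedNoise (G : CausalDiagram V) (Y : V) (T : Set V) (v : V) :
    Set (Shrink.{0} (Sym2 V)) :=
  {j | v ∈ T ∧ v ≠ Y ∧ ∃ a, Relation.ReflTransGen (G.induce T).dir a v ∧ j ∈ G.noise a}

/-- What `v` tells its children in the state `u`, encoded as the set of the states it does not
exclude. -/
def report (G : CausalDiagram V) (Y : V) (T : Set V) (v : V) (u : NoiseState V) :
    Set (NoiseState V) :=
  {u' | ∀ j ∈ G.reportedNoise Y T v, u' j = u j}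

variable {G : CausalDiagram V} {Y v w p : V} {T W : Set V} {u u' : NoiseState V}

theorem noise_nonempty (G : CausalDiagram V) (v : V) : (G.noise v).Nonempty :=
  (Set.insert_nonempty _ _).image _

theorem bidir_adj_iff_noise_inter_nonempty (h : v ≠ w) :
    G.bidir.Adj v w ↔ (G.noise v ∩ G.noise w).Nonempty := by
  rw [noise, noise, ← Set.image_inter (equivShrink _).injective, Set.image_nonempty]
  constructor
  · intro hvw
    exact ⟨s(v, w), .inr (G.bidir.mk'_mem_incidenceSet_left_iff.2 hvw),
      .inr (G.bidir.mk'_mem_incidenceSet_right_iff.2 hvw)⟩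
  · rintro ⟨e, rfl | hv, hw⟩
    · simp [h, SimpleGraph.mk'_mem_incidenceSet_iff] at hw
    · rcases hw with rfl | hw
      · simp [SimpleGraph.mk'_mem_incidenceSet_iff] at hv
      · exact G.bidir.adj_of_mem_incidenceSet h hv hw

theorem noise_subset_reportedNoise (hv : v ∈ T) (hvY : v ≠ Y) :
    G.noise v ⊆ G.reportedNoise Y T v :=
  fun _ hj => ⟨hv, hvY, v, .refl, hj⟩

theorem reportedNoise_subset_of_dir (hv : v ∈ T) (hvY : v ≠ Y) (h : G.dir p v) :
    G.reportedNoise Y T p ⊆ G.reportedNoise Y T v := by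
  rintro j ⟨hp, -, a, hap, hj⟩
  exact ⟨hv, hvY, a, hap.tail ⟨hp, hv, h⟩, hj⟩

theorem IsUCGenerated.mem_noise_or_exists_parent (hT : G.IsUCGenerated Y T)
    {j : Shrink.{0} (Sym2 V)} (hj : j ∈ G.reportedNoise Y T v) :
    j ∈ G.noise v ∨ ∃ p, G.dir p v ∧ j ∈ G.reportedNoise Y T p := by
  obtain ⟨hv, -, a, hav, hj⟩ := hj
  rcases hav.cases_tail with rfl | ⟨p, hap, hp, -, hpv⟩
  · exact .inl hj
  · exact .inr ⟨p, hpv, hp, fun h => hT.not_dir hv (h ▸ hpv), a, hap, hj⟩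

theorem mem_report_self : u ∈ G.report Y T v u :=
  fun _ _ => rfl

theorem report_eq_report_iff :
    G.report Y T v u = G.report Y T v u' ↔ ∀ j ∈ G.reportedNoise Y T v, u j = u' j := by
  refine ⟨fun h => h.subset mem_report_self, fun h => Set.ext fun s => ?_⟩
  exact forall₂_congr fun j hj => by rw [h j hj]

theorem report_of_notMem (hv : v ∉ T) : G.report Y T v u = Set.univ :=
  Set.eq_univ_of_forall fun _ _ hj => absurd hj.1 hv

theorem report_self : G.report Y T Y u = Set.univ :=
  Set.eq_univ_of_forall fun _ _ hj => absurd rfl hj.2.1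

/-- The SCM in which every vertex of `T` looks for a noise state that explains the reports of its
parents and its own noise, and reports accordingly; its value is `∅` if there is none. -/
noncomputable def reportSCM (G : CausalDiagram V) (Y : V) (T : Set V) : SCM G Y where
  Ω _ := Set (NoiseState V)
  finite_Ω _ := inferInstance
  nonempty_Ω _ := inferInstance
  val := (exists_injective_strictMono (Set (NoiseState V)) ℝ).choose
  val_injective := (exists_injective_strictMono (Set (NoiseState V)) ℝ).choose_spec.1
  ι := Shrink.{0} (Sym2 V)
  fintype_ι := Fintype.ofFinite _
  D _ := Bool
  measurableSpace_D _ := inferInstance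
  law _ := (PMF.uniformOfFintype Bool).toMeasure
  isProbabilityMeasure_law _ := inferInstance
  exo := G.noise
  f v pa e := {s | v ∈ T ∧ ∃ u' : NoiseState V, (∀ j : G.noise v, u' j = e j) ∧
    (∀ p, pa p = G.report Y T p.1 u') ∧ s ∈ G.report Y T v u'}
  measurable_f _ _ _ := (Set.toFinite _).measurableSet
  share_iff _ _ := bidir_adj_iff_noise_inter_nonempty

theorem reportSCM_val_lt_val_univ {s : Set (NoiseState V)} (hs : s ≠ Set.univ) :
    (G.reportSCM Y T).val s < (G.reportSCM Y T).val Set.univ :=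
  (exists_injective_strictMono (Set (NoiseState V)) ℝ).choose_spec.2 (Set.ssubset_univ_iff.2 hs)

theorem reportSCM_pi_law_singleton_ne_zero (u : ∀ j, (G.reportSCM Y T).D j) :
    Measure.pi (G.reportSCM Y T).law {u} ≠ 0 := by
  have hcoin (b : Bool) : (PMF.uniformOfFintype Bool).toMeasure {b} ≠ 0 := by
    rw [PMF.toMeasure_apply_singleton _ _ (measurableSet_singleton b)]
    exact (PMF.mem_support_iff _ _).1 (PMF.mem_support_uniformOfFintype b)
  exact (Measure.pi_singleton _ u).trans_ne (Finset.prod_ne_zero_iff.2 fun j _ => hcoin (u j))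

/-- The response of `reportSCM`, with its values seen as sets of noise states. -/
noncomputable def reportResponse (G : CausalDiagram V) (Y : V) (T W : Set V)
    (x : V → Set (NoiseState V)) (u : NoiseState V) (v : V) : Set (NoiseState V) :=
  (G.reportSCM Y T).response W x u v

variable {x : V → Set (NoiseState V)}

theorem reportResponse_of_mem (hv : v ∈ W) : G.reportResponse Y T W x u v = x v :=
  (G.reportSCM Y T).response_of_mem hv x u

theorem mem_reportResponse_iff (hv : v ∉ W) {s : NoiseState V} :
    s ∈ G.reportResponse Y T W x u v ↔
      v ∈ T ∧ ∃ u' : NoiseState V, (∀ j ∈ G.noise v, u' j = u j) ∧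
        (∀ p, G.dir p v → G.reportResponse Y T W x u p = G.report Y T p u') ∧
        s ∈ G.report Y T v u' := by
  rw [reportResponse, (G.reportSCM Y T).response_of_notMem hv x u]
  simp only [reportSCM, Set.mem_ofPred_eq, Subtype.forall]
  rfl

theorem IsUCGenerated.reportResponse_border (hT : G.IsUCGenerated Y T) (hv : v ∈ T) :
    G.reportResponse Y T (G.Pa T \ T) (fun _ => Set.univ) u v = G.report Y T v u := by
  induction v using G.wellFounded_dir.induction with
  | _ v ih =>
    have hparents (p : V) (hpv : G.dir p v) :
        G.reportResponse Y T (G.Pa T \ T) (fun _ => Set.univ) u p = G.report Y T p u := by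
      by_cases hp : p ∈ T
      · exact ih p hpv hp
      · rw [report_of_notMem hp, reportResponse_of_mem (W := G.Pa T \ T) ⟨⟨v, hv, hpv⟩, hp⟩]
    ext s
    rw [mem_reportResponse_iff fun h => h.2 hv]
    refine ⟨fun ⟨_, u', hnoise, hpar, hs⟩ => ?_, fun hs => ⟨hv, u, fun _ _ => rfl, hparents, hs⟩⟩
    suffices G.report Y T v u' = G.report Y T v u from this ▸ hs
    refine report_eq_report_iff.2 fun j hj => ?_
    rcases hT.mem_noise_or_exists_parent hj with hj | ⟨p, hpv, hj⟩
    · exact hnoise j hj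
    · exact report_eq_report_iff.1 ((hpar p hpv).symm.trans (hparents p hpv)) j hj

theorem exists_explanation_of_reportResponse_nonempty (hY : Y ∉ W)
    (h : (G.reportResponse Y T W x u Y).Nonempty) :
    ∃ u' : NoiseState V, ∀ v ∈ G.unblocked Y T W, (∀ j ∈ G.noise v, u' j = u j) ∧
      ∀ p, G.dir p v → G.reportResponse Y T W x u p = G.report Y T p u' := by
  obtain ⟨_, hs⟩ := h
  obtain ⟨-, u', hnoiseY, hparY, -⟩ := (mem_reportResponse_iff hY).1 hs
  refine ⟨u', fun v hv => ?_⟩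
  induction mem_an_singleton.1 hv using Relation.ReflTransGen.head_induction_on with
  | refl => exact ⟨hnoiseY, hparY⟩
  | @head v c hvc hcY ih =>
    obtain rfl | hvY := eq_or_ne v Y
    · exact ⟨hnoiseY, hparY⟩
    have hreport := (ih (mem_an_singleton.2 hcY)).2 v hvc.2.2
    obtain ⟨hvT, w, hnoise, hpar, hw⟩ :=
      (mem_reportResponse_iff hvc.1.2).1 (hreport.ge mem_report_self)
    refine ⟨fun j hj => (hw j (noise_subset_reportedNoise hvT hvY hj)).trans (hnoise j hj),
      fun p hpv => (hpar p hpv).trans (report_eq_report_iff.2 fun j hj => ?_)⟩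
    exact (hw j (reportedNoise_subset_of_dir hvT hvY hpv hj)).symm

theorem IsUCGenerated.exists_mem_noise_of_unblocked (hT : G.IsUCGenerated Y T)
    (hblocked : ¬ T ⊆ G.unblocked Y T W) :
    ∃ a ∈ G.unblocked Y T W, ∃ t ∈ T \ G.unblocked Y T W,
      ∃ j ∈ G.noise a, j ∈ G.reportedNoise Y T t := by
  obtain ⟨a, ha, t, ht, haT, hat⟩ := hT.exists_edge_of_not_subset self_mem_unblocked hblocked
  have htY : t ≠ Y := (ne_of_mem_of_not_mem self_mem_unblocked ht.2).symm
  refine ⟨a, ha, t, ht, ?_⟩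
  rcases hat with h | h
  · obtain ⟨j, hj⟩ := G.noise_nonempty a
    exact ⟨j, hj, ht.1, htY, a, .single ⟨haT, ht.1, h⟩, hj⟩
  · obtain ⟨j, hja, hjt⟩ := (bidir_adj_iff_noise_inter_nonempty h.ne).1 h
    exact ⟨j, hja, noise_subset_reportedNoise ht.1 htY hjt⟩

theorem IsUCGenerated.exists_reportedNoise_subset (hT : G.IsUCGenerated Y T) (hY : Y ∉ W)
    (hv : v ∈ T \ G.unblocked Y T W) :
    ∃ w ∈ W, ∃ c ∈ G.unblocked Y T W, G.dir w c ∧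
      G.reportedNoise Y T v ⊆ G.reportedNoise Y T w := by
  obtain ⟨hvT, hvA⟩ := hv
  induction hT.reaches v hvT using Relation.ReflTransGen.head_induction_on with
  | refl => exact absurd self_mem_unblocked hvA
  | @head v c hvc _ ih =>
    obtain ⟨-, hcT, hvc⟩ := hvc
    by_cases hcA : c ∈ G.unblocked Y T W
    · have hvW : v ∈ W := by
        by_contra hvW
        exact hvA (mem_unblocked_of_dir ⟨hT.mem, hY⟩ ⟨hvT, hvW⟩ hcA hvc)
      exact ⟨v, hvW, c, hcA, hvc, subset_rfl⟩
    · obtain ⟨w, hw, d, hd, hwd, hcw⟩ := ih hcT hcA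
      have hcY : c ≠ Y := (ne_of_mem_of_not_mem self_mem_unblocked hcA).symm
      exact ⟨w, hw, d, hd, hwd, (reportedNoise_subset_of_dir hcT hcY hvc).trans hcw⟩

theorem IsUCGenerated.exists_reportResponse_eq_empty_of_blocked (hT : G.IsUCGenerated Y T)
    (hY : Y ∉ W) (hblocked : ¬ T ⊆ G.unblocked Y T W) (x : V → Set (NoiseState V)) :
    ∃ u, G.reportResponse Y T W x u Y = ∅ := by
  obtain ⟨a, ha, t, ht, j, hja, hjt⟩ := hT.exists_mem_noise_of_unblocked hblocked
  obtain ⟨w, hw, c, hc, hwc, htw⟩ := hT.exists_reportedNoise_subset hY ht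
  by_contra! hne
  -- The fixed value of `w` would have to agree with the coin `j`, whichever way it falls.
  have hcoin (b : Bool) : ∃ u' : NoiseState V, u' j = b ∧ x w = G.report Y T w u' := by
    obtain ⟨u', hu'⟩ := exists_explanation_of_reportResponse_nonempty hY (hne fun _ => b)
    exact ⟨u', (hu' a ha).1 j hja, (reportResponse_of_mem hw).symm.trans ((hu' c hc).2 w hwc)⟩
  obtain ⟨u, hu, hxu⟩ := hcoin true
  obtain ⟨u', hu', hxu'⟩ := hcoin false
  have huu' := report_eq_report_iff.1 (hxu.symm.trans hxu') j (htw hjt)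
  exact Bool.true_eq_false_eq_False (hu.symm.trans (huu'.trans hu'))

theorem reportResponse_eq_empty_of_parent (hY : Y ∉ W) (hc : v ∈ G.unblocked Y T W)
    (hp : p ∉ T ∪ W) (hpv : G.dir p v) : G.reportResponse Y T W x u Y = ∅ := by
  obtain ⟨hpT, hpW⟩ := not_or.1 hp
  by_contra hne
  obtain ⟨u', hu'⟩ :=
    exists_explanation_of_reportResponse_nonempty hY (Set.nonempty_iff_ne_empty.2 hne)
  have hs : u' ∈ G.reportResponse Y T W x u p := ((hu' v hc).2 p hpv).ge mem_report_self
  exact hpT ((mem_reportResponse_iff hpW).1 hs).1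

theorem IsUCGenerated.exists_reportResponse_eq_empty (hT : G.IsUCGenerated Y T) (hY : Y ∉ W)
    (hW : ¬ G.Isolates W T) (x : V → Set (NoiseState V)) :
    ∃ u, G.reportResponse Y T W x u Y = ∅ := by
  by_cases hsub : T ⊆ G.unblocked Y T W
  · have hdisj : Disjoint W T :=
      Set.disjoint_right.2 fun t ht => (unblocked_subset ⟨hT.mem, hY⟩ (hsub ht)).2
    obtain ⟨b, ⟨⟨t, ht, hbt⟩, hbT⟩, hbW⟩ := Set.not_subset.1 fun h => hW ⟨hdisj, h⟩
    exact ⟨fun _ => true, reportResponse_eq_empty_of_parent hY (hsub ht) (not_or.2 ⟨hbT, hbW⟩) hbt⟩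
  · exact hT.exists_reportResponse_eq_empty_of_blocked hY hsub x

end Reports

section Optimality

variable {G : CausalDiagram V} {Y : V} {X W T : Set V}

theorem IsUCGenerated.optReward_reportSCM_lt (hT : G.IsUCGenerated Y T) (hY : Y ∉ W)
    (hW : ¬ G.Isolates W T) :
    (G.reportSCM Y T).optReward W < (G.reportSCM Y T).optReward (G.Pa T \ T) := by
  set M := G.reportSCM Y T
  have hborder : M.expReward (G.Pa T \ T) (fun _ => Set.univ) = M.val Set.univ := by
    have hresponse (u : ∀ j, M.D j) :
        M.response (G.Pa T \ T) (fun _ => Set.univ) u Y = (Set.univ : Set (NoiseState V)) :=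
      (hT.reportResponse_border hT.mem).trans report_self
    simp [SCM.expReward, hresponse]
  obtain ⟨x, hx⟩ := M.exists_expReward_eq_optReward W
  obtain ⟨u, hu⟩ := hT.exists_reportResponse_eq_empty hY hW x
  have hlt : M.expReward W x < M.val Set.univ := by
    refine integral_lt_of_le_of_lt_at_atom (M.integrable_reward W x) (fun u => ?_)
      (reportSCM_pi_law_singleton_ne_zero u) (reportSCM_val_lt_val_univ ?_)
    · obtain h | h := eq_or_ne (G.reportResponse Y T W x u Y) Set.univ
      · exact (congrArg M.val h).le
      · exact (reportSCM_val_lt_val_univ h).le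
    · exact hu.trans_ne Set.empty_ne_univ
  calc M.optReward W = M.expReward W x := hx.symm
    _ < M.val Set.univ := hlt
    _ = M.expReward (G.Pa T \ T) (fun _ => Set.univ) := hborder.symm
    _ ≤ M.optReward (G.Pa T \ T) := M.expReward_le_optReward _ _

theorem IsUCGenerated.exists_optReward_lt (hT : G.IsUCGenerated Y T) :
    ∃ M : SCM G Y, ∀ W, Y ∉ W → ¬ G.Isolates W T → M.optReward W < M.optReward (G.Pa T \ T) :=
  ⟨G.reportSCM Y T, fun _ => hT.optReward_reportSCM_lt⟩

theorem EquivIS.optReward_eq (h : G.EquivIS Y X W) (M : SCM G Y) :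
    M.optReward X = M.optReward W :=
  iSup_congr (h M)

theorem Isolates.equivIS_border (hX : G.Isolates X T) (hY : Y ∈ T) :
    G.EquivIS Y X (G.Pa T \ T) :=
  fun M x => M.expReward_eq_of_isolates hY hX x

theorem IsUCGenerated.not_equivIS (hT : G.IsUCGenerated Y T) (hW : G.Isolates W T) (hY : Y ∉ X)
    (hX : ¬ G.Isolates X T) : ¬ G.EquivIS Y X W := by
  intro h
  obtain ⟨M, hM⟩ := hT.exists_optReward_lt
  refine (hM X hY hX).ne ?_
  rw [h.optReward_eq, (hW.equivIS_border hT.mem).optReward_eq]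

theorem IsUCGenerated.isPOIS (hT : G.IsUCGenerated Y T) (hX : G.Isolates X T) :
    G.IsPOIS Y X := by
  obtain ⟨M, hM⟩ := hT.exists_optReward_lt
  refine ⟨fun hY => Set.disjoint_left.1 hX.disjoint hY hT.mem, M, fun W hY hXW => ?_⟩
  rw [(hX.equivIS_border hT.mem).optReward_eq]
  refine hM W hY fun hW => hXW fun M x => ?_
  rw [hX.equivIS_border hT.mem, hW.equivIS_border hT.mem]

theorem IsUCGenerated.isPOMIS (hT : G.IsUCGenerated Y T) : G.IsPOMIS Y (G.Pa T \ T) := by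
  have hB := G.isolates_border T
  have hYB : Y ∉ G.Pa T \ T := fun h => h.2 hT.mem
  obtain ⟨M, hM⟩ := hT.exists_optReward_lt
  refine ⟨⟨hYB, ?_⟩, M, fun W ⟨hYW, hmin⟩ hne => hM W hYW fun hW => hmin ?_⟩
  · rintro ⟨X, hXB, hequiv⟩
    refine hT.not_equivIS hB (fun h => hYB (hXB.subset h)) (fun hX => ?_) fun M x =>
      (hequiv M x).symm
    exact hXB.2 hX.border_subset
  · exact ⟨_, hW.border_subset.ssubset_of_ne hne.symm, hW.equivIS_border hT.mem⟩

theorem IsPOIS.ib_subset (h : G.IsPOIS Y X) : (G.removeIncoming X).IB Y ⊆ X := by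
  obtain ⟨hX, M, hM⟩ := h
  have hT := G.isUCGenerated_muct_removeIncoming Y X
  have hW : G.Isolates (X ∪ (G.removeIncoming X).IB Y) _ := isolates_union_ib hX
  by_contra hsub
  refine (M.optReward_le_optReward_union_ib hX).not_gt (hM _ ?_ ?_)
  · exact fun hYW => Set.disjoint_left.1 hW.disjoint hYW hT.mem
  · refine hT.not_equivIS hW hX fun hXT => hsub ?_
    rw [ib_removeIncoming hX]
    exact hXT.border_subset

end Optimality

end CausalDiagram

theorem mainTheorem5 {V : Type*} [Finite V] (G : CausalDiagram V) (Y : V) (X : Set V)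
    (hX : Y ∉ X) :
    (G.IsPOIS Y X → (G.removeIncoming X).IB Y ⊆ X) ∧
    ((G.IsPOIS Y X ∧ X ⊆ G.An {Y}) ↔
      ((G.removeIncoming X).IB Y ⊆ X ∧
        X ⊆ G.An ((G.removeIncoming X).MUCT Y) \ (G.removeIncoming X).MUCT Y)) ∧
    (X = (G.removeIncoming X).IB Y → G.IsPOMIS Y X) := by
  set T := (G.removeIncoming X).MUCT Y
  have hT : G.IsUCGenerated Y T := G.isUCGenerated_muct_removeIncoming Y X
  have hdisj : Disjoint X T := CausalDiagram.disjoint_muct_removeIncoming hX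
  have hIB : (G.removeIncoming X).IB Y = G.Pa T \ T := CausalDiagram.ib_removeIncoming hX
  have hAn : G.An T = G.An {Y} := hT.an_eq
  refine ⟨fun h => h.ib_subset, ⟨fun ⟨hPOIS, hXA⟩ => ⟨hPOIS.ib_subset, ?_⟩,
    fun ⟨hsub, hXT⟩ => ⟨hT.isPOIS ⟨hdisj, hIB ▸ hsub⟩, ?_⟩⟩, fun h => ?_⟩
  · exact hAn ▸ Set.subset_sdiff.2 ⟨hXA, hdisj⟩
  · exact hAn ▸ hXT.trans Set.sdiff_subset
  · exact (h.trans hIB) ▸ hT.isPOMIS
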